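/- \textbf{Non-degenerate critical points are isolated.} \emph{Notation.} Let $d\in\mathbb N$. For $A\subset\mathbb R^d$ let $d_A$ be the distance function of $A$, let $\complement A:=\overline{\mathbb R^d\setminus A}$, and let $\operatorname{Tan}(A,x)$ be the tangent cone of $A$ at $x$: the set of all limits $\lim_i c_i(x_i-x)$ with $c_i\ge 0$, $x_i\in A$, $x_i\to x$ (so $0\in \operatorname{Tan}(A,x)$ for $x\in A$). Write $B^{\mathrm o}=\{u:\langle u,b\rangle\le 0\ \forall b\in B\}$. The \emph{reach} of $A$ is the largest $t\in[0,\infty]$ such that every $x$ with $d_A(x)<t$ has a unique closest point in $A$. For $\mu\in(0,1]$, $\operatorname{reach}_\mu(A)$ is the supremum of the $s\ge 0$ such that every element of the Clarke gradient of $d_A$ at $x$ has norm at least $\mu$ whenever $0<d_A(x)\le s$; here the Clarke gradient of a locally Lipschitz function $\varphi$ at $x$ is the convex hull of the limits $\lim_i\nabla\varphi(x_i)$, where $x_i\to x$ and $\varphi$ is differentiable at each $x_i$. A compact set $X\subset\mathbb R^d$ is \emph{complementary regular} if $\overline{\operatorname{int}X}=X$, $\operatorname{reach}_\mu(X)>0$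 for some $\mu\in(0,1]$, and $\operatorname{reach}(\complement X)>0$. Let $X\subset\mathbb R^d$ have positive reach or be complementary regular. For $x\in X$ put $\operatorname{Nor}(X,x):=\operatorname{Tan}(X,x)^{\mathrm o}$ if $X$ has positive reach; otherwise put $\operatorname{Nor}(X,x):=-\operatorname{Tan}(\complement X,x)^{\mathrm o}$ for $x\in\partial X$ and $\operatorname{Nor}(X,x):=\{0\}$ for $x\in\operatorname{int}X$. The normal bundle is $\operatorname{Nor}(X):=\{(x,n): x\in\partial X,\ n\in\operatorname{Nor}(X,x),\ \|n\|=1\}$. A pair $(x,n)\in\operatorname{Nor}(X)$ is \emph{regular} if $T_{x,n}:=\operatorname{Tan}(\operatorname{Nor}(X),(x,n))$ is a vector space of dimension $d-1$. In that case, with $\pi_0(u,v):=u$, the second fundamental form of $X$ at $(x,n)$ is the bilinear form on $\pi_0(T_{x,n})$ given by $\mathrm{II}_{x,n}(u,u'):=\langle u,v'\rangle$ for $(u,v),(u',v')\in T_{x,n}$. Let $f:\mathbb R^d\to\mathbb R$ be of class $C^2$. A point $x\in X$ is a \emph{critical point} of $f_{|X}$ if $-\nabla f(x)\in\operatorname{Nor}(X,x)$.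 It is \emph{non-degenerate} if moreover $\nabla f(x)\ne 0$, the pair $(x,n)$ with $n:=-\nabla f(x)/\|\nabla f(x)\|$ is regular, and the bilinear form $$H_xf_{|X}(u,u'):=H_xf(u,u')+\|\nabla f(x)\|\,\mathrm{II}_{x,n}(u,u')$$ on $\pi_0(T_{x,n})$ is non-degenerate, where $H_xf$ is the Hessian of $f$ at $x$. \emph{Statement.} Let $X\subset\mathbb R^d$ be a set of positive reach or a complementary regular set, and let $f:\mathbb R^d\to\mathbb R$ be of class $C^2$. Then every non-degenerate critical point $x$ of $f_{|X}$ is isolated in the set of critical points of $f_{|X}$: there is a neighbourhood $U$ of $x$ such that $x$ is the only critical point of $f_{|X}$ in $U$. -/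

import Mathlib

open Set Filter Topology
open scoped ENNReal Pointwise RealInnerProductSpace

namespace MorseReach

noncomputable section

/-- Euclidean space `ℝᵈ`. -/
abbrev E (d : ℕ) : Type := EuclideanSpace ℝ (Fin d)

/-! ### Distance functions, reach and `μ`-reach -/

/-- The complement set: the closure of the set-theoretic complement. -/
def complSet {d : ℕ} (X : Set (E d)) : Set (E d) := closure Xᶜ

/-- The reach of `X`: the largest `t` such that every point at distance `< t` from `X` has a unique
closest point in `X`. -/
def reach {d : ℕ} (X : Set (E d)) : ℝ≥0∞ :=
  sSup {t : ℝ≥0∞ | ∀ x : E d, Metric.infEDist x X < t →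
    ∃! z : E d, z ∈ X ∧ edist x z = Metric.infEDist x X}

/-- The Clarke gradient of `φ` at `x`: the convex hull of all limits of `∇φ(xᵢ)`, where `xᵢ → x` and
`φ` is differentiable at every `xᵢ`. -/
def clarkeGradient {d : ℕ} (φ : E d → ℝ) (x : E d) : Set (E d) :=
  convexHull ℝ {g : E d | ∃ y : ℕ → E d, Tendsto y atTop (𝓝 x) ∧
    (∀ i, DifferentiableAt ℝ φ (y i)) ∧ Tendsto (fun i => gradient φ (y i)) atTop (𝓝 g)}

/-- `Δ(A) = inf {‖a‖ : a ∈ A}`, the distance from the origin to `A`. -/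
def minNorm {d : ℕ} (A : Set (E d)) : ℝ := Metric.infDist 0 A

/-- The `μ`-reach of `X`: the supremum of the `s ≥ 0` such that `Δ(∂d_X(x)) ≥ μ` at every point `x`
outside the closure of `X` with `d_X(x) ≤ s`. -/
def muReach {d : ℕ} (μ : ℝ) (X : Set (E d)) : ℝ≥0∞ :=
  sSup {t : ℝ≥0∞ | ∃ s : ℝ, 0 ≤ s ∧ t = ENNReal.ofReal s ∧
    ∀ x : E d, 0 < Metric.infDist x X → Metric.infDist x X ≤ s →
      μ ≤ minNorm (clarkeGradient (fun y => Metric.infDist y X) x)}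

/-- Complementary regular sets. -/
structure IsComplementaryRegular {d : ℕ} (X : Set (E d)) : Prop where
  isCompact : IsCompact X
  closure_interior : closure (interior X) = X
  muReach_pos : ∃ μ : ℝ, 0 < μ ∧ μ ≤ 1 ∧ 0 < muReach μ X
  reach_compl_pos : 0 < reach (complSet X)

/-! ### Normal cones and normal bundles -/

/-- The polar cone `{u : ⟪u, b⟫ ≤ 0 for all b ∈ B}`. -/
def polarCone {d : ℕ} (B : Set (E d)) : Set (E d) := {u | ∀ b ∈ B, ⟪u, b⟫ ≤ 0}

/-- The normal cone `Nor(X, x)` at a point `x ∈ X`: the polar of the tangent cone of `X` at `x` if `X`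
has positive reach; otherwise the opposite of the normal cone at `x` of the complement set, which
is `{0}` at points of the interior of `X`, where the complement set is absent.
Mathlib's `posTangentConeAt` is the cone of the limits of `cᵢ • (xᵢ - x)`, `xᵢ ∈ X`, `xᵢ → x`,
`cᵢ ≥ 0`. -/
def normalCone {d : ℕ} (X : Set (E d)) (x : E d) : Set (E d) :=
  open scoped Classical in
  if 0 < reach X then polarCone (posTangentConeAt X x)
  else if x ∈ interior X then {0}
  else -polarCone (posTangentConeAt (complSet X) x)

/-- The (unit) normal bundle `Nor(X) ⊆ ℝᵈ × 𝕊ᵈ⁻¹`. -/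
def normalBundle {d : ℕ} (X : Set (E d)) : Set (E d × E d) :=
  {p | p.1 ∈ frontier X ∧ p.2 ∈ normalCone X p.1 ∧ ‖p.2‖ = 1}

/-- The linear span of the tangent cone `Tan(Nor(X), p)`; at a regular pair `p` it is that cone
itself. -/
def bundleTangent {d : ℕ} (X : Set (E d)) (p : E d × E d) : Submodule ℝ (E d × E d) :=
  Submodule.span ℝ (posTangentConeAt (normalBundle X) p)

/-- A pair `p ∈ Nor(X)` is regular when `Tan(Nor(X), p)` is a vector space of dimension `d - 1`. -/
structure IsRegularPair {d : ℕ} (X : Set (E d)) (p : E d × E d) : Prop where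
  mem : p ∈ normalBundle X
  coe_eq : (bundleTangent X p : Set (E d × E d)) = posTangentConeAt (normalBundle X) p
  finrank_add_one : Module.finrank ℝ (bundleTangent X p) + 1 = d

/-! ### Second fundamental form, Hessian, critical points -/

/-- The projection `π₀(V) ⊆ ℝᵈ` of `V ⊆ ℝᵈ × ℝᵈ` onto the first factor. -/
def baseSpace {d : ℕ} (V : Submodule ℝ (E d × E d)) : Submodule ℝ (E d) :=
  V.map (LinearMap.fst ℝ (E d) (E d))

theorem exists_lift {d : ℕ} (V : Submodule ℝ (E d × E d)) :
    ∃ s : baseSpace V →ₗ[ℝ] E d, ∀ u : baseSpace V, ((u : E d), s u) ∈ V := by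
  let g : V →ₗ[ℝ] baseSpace V := (LinearMap.fst ℝ (E d) (E d)).submoduleMap V
  obtain ⟨t, ht⟩ := g.exists_rightInverse_of_surjective
    (LinearMap.range_eq_top.2 ((LinearMap.fst ℝ (E d) (E d)).submoduleMap_surjective V))
  refine ⟨LinearMap.snd ℝ (E d) (E d) ∘ₗ V.subtype ∘ₗ t, fun u => ?_⟩
  have h1 : ((t u : V) : E d × E d).1 = (u : E d) :=
    congrArg Subtype.val (LinearMap.congr_fun ht u)
  have h2 : ((u : E d), ((t u : V) : E d × E d).2) = ((t u : V) : E d × E d) := by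
    rw [← h1]
  simp [h2]

/-- A linear choice, for `u ∈ π₀(V)`, of a vector `v` with `(u, v) ∈ V`. -/
def lift {d : ℕ} (V : Submodule ℝ (E d × E d)) : baseSpace V →ₗ[ℝ] E d :=
  (exists_lift V).choose

theorem lift_mem {d : ℕ} (V : Submodule ℝ (E d × E d)) (u : baseSpace V) :
    ((u : E d), lift V u) ∈ V := (exists_lift V).choose_spec u

/-- The form `(u, u') ↦ ⟪u, v'⟫` on `π₀(V)`, where `(u', v') ∈ V`. -/
def pairingForm {d : ℕ} (V : Submodule ℝ (E d × E d)) : LinearMap.BilinForm ℝ (baseSpace V) :=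
  (innerₗ (E d)).compl₁₂ (baseSpace V).subtype (lift V)

/-- As soon as `⟪u, v'⟫` depends only on `u` and `u'`, it is the value of the form,
whatever the choice of `v'`. -/
theorem pairingForm_apply {d : ℕ} (V : Submodule ℝ (E d × E d))
    (h : ∀ w : E d, ((0 : E d), w) ∈ V → ∀ u ∈ baseSpace V, ⟪u, w⟫ = 0)
    (u u' : baseSpace V) (v' : E d) (hv : ((u' : E d), v') ∈ V) :
    pairingForm V u u' = ⟪(u : E d), v'⟫ := by
  have h0 : ((0 : E d), lift V u' - v') ∈ V := by
    simpa using V.sub_mem (lift_mem V u') hv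
  have h1 := h _ h0 u u.2
  rw [inner_sub_right] at h1
  simpa [pairingForm] using sub_eq_zero.1 h1

/-- The second fundamental form of `X` at the (regular) pair `p`, on `π₀(Tan(Nor(X), p))`. -/
def secondFundamentalForm {d : ℕ} (X : Set (E d)) (p : E d × E d) :
    LinearMap.BilinForm ℝ (baseSpace (bundleTangent X p)) :=
  pairingForm (bundleTangent X p)

/-- The second derivative `H_x f` as a bilinear form. -/
def hessian {d : ℕ} (f : E d → ℝ) (x : E d) : LinearMap.BilinForm ℝ (E d) :=
  ContinuousLinearMap.toLinearMap₁₂ (fderiv ℝ (fderiv ℝ f) x)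

/-- `n = -∇f(x) / ‖∇f(x)‖`. -/
def unitNormal {d : ℕ} (f : E d → ℝ) (x : E d) : E d := -(‖gradient f x‖⁻¹ • gradient f x)

/-- The Hessian of `f|_X` at `x`: the form `H_x f + ‖∇f(x)‖ II_{x,n}` on `π₀(Tan(Nor(X), (x, n)))`. -/
def restrictedHessian {d : ℕ} (f : E d → ℝ) (X : Set (E d)) (x : E d) :
    LinearMap.BilinForm ℝ (baseSpace (bundleTangent X (x, unitNormal f x))) :=
  (hessian f x).restrict _ + ‖gradient f x‖ • secondFundamentalForm X (x, unitNormal f x)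

/-- `x` is a critical point of `f|_X`. -/
def IsCriticalPoint {d : ℕ} (f : E d → ℝ) (X : Set (E d)) (x : E d) : Prop :=
  x ∈ X ∧ gradient f x ∈ -normalCone X x

/-- `x` is a non-degenerate critical point of `f|_X`. -/
structure IsNondegenerateCriticalPoint {d : ℕ} (f : E d → ℝ) (X : Set (E d)) (x : E d) : Prop where
  isCriticalPoint : IsCriticalPoint f X x
  gradient_ne_zero : gradient f x ≠ 0
  isRegularPair : IsRegularPair X (x, unitNormal f x)
  nondegenerate : (restrictedHessian f X x).Nondegenerate

end

end MorseReach

/-!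
The proof rests on two facts about the unit normal bundle `N` of `X`.

*Uniform proximality* (Federer). If every point at distance less than `r` from `A` has a unique
closest point in `A`, then `2 r ⟪y - x, n⟫ ≤ ‖n‖ ‖y - x‖²` for `x, y ∈ A` and `n` polar to the
tangent cone of `A` at `x`. Indeed, a segment from a closest point `a` to `z` can be prolonged: a
point farthest from `A` in a small ball around `z` must lie on the ray from its own closest point
through `z`, and that closest point is then `a`. Hence the open ball of radius `s < r` touching `A`
at `a` from the direction of `z` misses `A`. Vectors polar to the tangent cone are limits of such
directions.

*Tangent vectors of `N`.* If the tangent cone `T` of `N` at `(x, n)` is a vector space, the bound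
above, for `A = X` or for the closed complement, forces `⟪u, n⟫ = 0` for `(u, v) ∈ T`, and, being
quadratic and one-sided, it forces `⟪u, w⟫ = 0` for `(u, v), (0, w) ∈ T`. So the second fundamental
form is well defined.

If critical points accumulate at `x`, then, along a subsequence, their directions from `x` converge
to some `u ≠ 0`. The map `y ↦ (y, n(y))`, with `n = -∇f / ‖∇f‖`, sends them into `N`, so
`(u, Dn(x) u) ∈ T`. Since `‖∇f(x)‖ ⟪u', Dn(x) u⟫ = -H_x f(u', u)` for `u' ⟂ n(x)`, the vector `u`
lies in the kernel of the Hessian of `f|_X`.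
-/

namespace MorseReach

section ClosestPoint

/-- `p` is a point of `X` realizing the distance from `z` to `X`. -/
def IsClosestPoint {V : Type*} [PseudoMetricSpace V] (X : Set V) (z p : V) : Prop :=
  p ∈ X ∧ dist z p = Metric.infDist z X

/-- Every point at distance less than `r` from `X` has a unique closest point in `X`: the condition
defining the reach, for a real radius. It fails for `X = ∅` and `0 < r`, as `Metric.infDist z ∅ = 0`
for all `z`. -/
def HasUniqueClosestPoints {V : Type*} [PseudoMetricSpace V] (X : Set V) (r : ℝ) : Prop :=
  ∀ z : V, Metric.infDist z X < r → ∃! p : V, IsClosestPoint X z p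

theorem HasUniqueClosestPoints.isClosed {V : Type*} [MetricSpace V] {X : Set V} {r : ℝ}
    (hX : HasUniqueClosestPoints X r) (hr : 0 < r) : IsClosed X := by
  rcases X.eq_empty_or_nonempty with rfl | hne
  · exact isClosed_empty
  refine isClosed_of_closure_subset fun x hx => ?_
  have hx0 : Metric.infDist x X = 0 := (Metric.mem_closure_iff_infDist_zero hne).1 hx
  obtain ⟨p, ⟨hp, hdist⟩, -⟩ := hX x (hx0.trans_lt hr)
  rw [hx0, dist_eq_zero] at hdist
  exact hdist ▸ hp

variable {V : Type*} [PseudoMetricSpace V] [ProperSpace V] {X : Set V}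

theorem exists_isClosestPoint (hX : IsClosed X) (hne : X.Nonempty) (z : V) :
    ∃ p, IsClosestPoint X z p := by
  obtain ⟨p, hp, hdist⟩ := hX.exists_infDist_eq_dist hne z
  exact ⟨p, hp, hdist.symm⟩

theorem tendsto_of_isClosestPoint {α : Type*} {l : Filter α} (hX : IsClosed X) {y q : α → V}
    {z p : V} (hy : Tendsto y l (𝓝 z)) (hq : ∀ i, IsClosestPoint X (y i) (q i))
    (huniq : ∀ p', IsClosestPoint X z p' → p' = p) : Tendsto q l (𝓝 p) := by
  have hinf : Tendsto (fun i => Metric.infDist (y i) X) l (𝓝 (Metric.infDist z X)) :=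
    ((Metric.continuous_infDist_pt X).tendsto z).comp hy
  have hbdd : ∀ᶠ i in l, q i ∈ Metric.closedBall z (0 + Metric.infDist z X + 1) := by
    have hsum := (tendsto_iff_dist_tendsto_zero.1 hy).add hinf
    filter_upwards [hsum.eventually_le_const (lt_add_one _)] with i hi
    rw [← (hq i).2] at hi
    exact (dist_triangle_left (q i) z (y i)).trans (by linarith)
  refine (isCompact_closedBall z _).tendsto_nhds_of_unique_mapClusterPt hbdd fun p' _ hp' => ?_
  obtain ⟨U, hU, hqU⟩ := mapClusterPt_iff_ultrafilter.1 hp'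
  refine huniq p' ⟨hX.mem_of_tendsto hqU (Eventually.of_forall fun i => (hq i).1), ?_⟩
  refine tendsto_nhds_unique ((hy.mono_left hU).dist hqU) ((hinf.mono_left hU).congr fun i => ?_)
  exact (hq i).2.symm

end ClosestPoint

section UniqueProjection

theorem tendsto_add_smul_nhdsGT_zero {V : Type*} [AddCommGroup V] [Module ℝ V]
    [TopologicalSpace V] [ContinuousAdd V] [ContinuousSMul ℝ V] (z h : V) :
    Tendsto (fun t : ℝ => z + t • h) (𝓝[>] 0) (𝓝 z) := by
  have hcont : Continuous fun t : ℝ => z + t • h := by fun_prop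
  simpa using (hcont.tendsto 0).mono_left nhdsWithin_le_nhds

variable {V : Type*} [NormedAddCommGroup V] [InnerProductSpace ℝ V] {X : Set V}

theorem inner_nonpos_of_norm_smul_add_le {h v : V} {t : ℝ} (ht : 0 < t)
    (hle : ‖t • h + v‖ ≤ ‖v‖) : ⟪h, v⟫ ≤ 0 := by
  have hsq : ‖t • h + v‖ ^ 2 ≤ ‖v‖ ^ 2 := by gcongr
  rw [norm_add_sq_real, real_inner_smul_left] at hsq
  have hprod : t * ⟪h, v⟫ ≤ 0 := by linarith [sq_nonneg ‖t • h‖]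
  exact nonpos_of_mul_nonpos_right hprod ht

theorem inner_sub_nonpos_of_infDist_add_smul_le [ProperSpace V] (hX : IsClosed X) {z p h : V}
    (hp : IsClosestPoint X z p) (huniq : ∀ p', IsClosestPoint X z p' → p' = p)
    (hle : ∀ᶠ t in 𝓝[>] (0 : ℝ), Metric.infDist (z + t • h) X ≤ Metric.infDist z X) :
    ⟪h, z - p⟫ ≤ 0 := by
  choose q hq using fun t : ℝ => exists_isClosestPoint hX ⟨p, hp.1⟩ (z + t • h)
  have hqp : Tendsto q (𝓝[>] 0) (𝓝 p) :=
    tendsto_of_isClosestPoint hX (tendsto_add_smul_nhdsGT_zero z h) hq huniq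
  refine le_of_tendsto (tendsto_const_nhds.inner (tendsto_const_nhds.sub hqp)) ?_
  filter_upwards [hle, self_mem_nhdsWithin] with t ht ht0
  refine inner_nonpos_of_norm_smul_add_le ht0 ?_
  calc ‖t • h + (z - q t)‖ = Metric.infDist (z + t • h) X := by
        rw [← (hq t).2, dist_eq_norm]; congr 1; abel
    _ ≤ Metric.infDist z X := ht
    _ ≤ ‖z - q t‖ := by rw [← dist_eq_norm]; exact Metric.infDist_le_dist_of_mem (hq t).1

theorem norm_smul_eq_smul_of_forall_inner_sub_nonpos {v w : V} {ε : ℝ} (hv : ‖v‖ ≤ ε)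
    (hw : w ≠ 0) (hmax : ∀ y, ‖y‖ ≤ ε → ⟪y - v, w⟫ ≤ 0) : ‖w‖ • v = ε • w := by
  have hw0 : 0 < ‖w‖ := norm_pos_iff.2 hw
  have hε : 0 ≤ ε := (norm_nonneg v).trans hv
  have htop := hmax ((ε / ‖w‖) • w) (by
    rw [norm_smul, norm_div, norm_norm, div_mul_cancel₀ _ hw0.ne', Real.norm_of_nonneg hε])
  rw [inner_sub_left, real_inner_smul_left, real_inner_self_eq_norm_sq,
    show ε / ‖w‖ * ‖w‖ ^ 2 = ε * ‖w‖ by field_simp] at htop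
  have hcs : ⟪v, w⟫ ≤ ‖v‖ * ‖w‖ := real_inner_le_norm v w
  have hvε : ‖v‖ = ε := le_antisymm hv (le_of_mul_le_mul_right (by linarith) hw0)
  subst hvε
  exact inner_eq_norm_mul_iff_real.1 (le_antisymm hcs (by linarith))

theorem HasUniqueClosestPoints.exists_norm_smul_sub_eq [ProperSpace V] {r : ℝ}
    (hX : HasUniqueClosestPoints X r) {z₀ : V} {ε : ℝ} (hε : 0 ≤ ε)
    (hpos : 0 < Metric.infDist z₀ X) (hr : Metric.infDist z₀ X + ε < r) :
    ∃ z p, IsClosestPoint X z p ∧ Metric.infDist z₀ X ≤ Metric.infDist z X ∧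
      Metric.infDist z X ≤ Metric.infDist z₀ X + ε ∧ ‖z - p‖ • (z - z₀) = ε • (z - p) := by
  obtain ⟨z, hz, hmax⟩ := (isCompact_closedBall z₀ ε).exists_isMaxOn
    (Metric.nonempty_closedBall.2 hε) (Metric.continuous_infDist_pt X).continuousOn
  have hge : Metric.infDist z₀ X ≤ Metric.infDist z X := hmax (Metric.mem_closedBall_self hε)
  have hle : Metric.infDist z X ≤ Metric.infDist z₀ X + ε :=
    Metric.infDist_le_infDist_add_dist.trans (by gcongr; exact hz)
  obtain ⟨p, hp, huniq⟩ := hX z (hle.trans_lt hr)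
  refine ⟨z, p, hp, hge, hle, norm_smul_eq_smul_of_forall_inner_sub_nonpos
    (mem_closedBall_iff_norm.1 hz) ?_ fun y hy => ?_⟩
  · rw [← norm_pos_iff, ← dist_eq_norm, hp.2]
    exact hpos.trans_le hge
  · refine inner_sub_nonpos_of_infDist_add_smul_le (hX.isClosed (by linarith)) hp huniq ?_
    filter_upwards [Ioc_mem_nhdsGT one_pos] with t ht
    rw [show y - (z - z₀) = (z₀ + y) - z by abel]
    exact hmax ((convex_closedBall z₀ ε).add_smul_sub_mem hz (by simpa using hy) ⟨ht.1.le, ht.2⟩)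

theorem HasUniqueClosestPoints.infDist_add_one_add_smul [ProperSpace V] {r : ℝ}
    (hX : HasUniqueClosestPoints X r) {a v : V} (ha : a ∈ X) (hv : Metric.infDist (a + v) X = ‖v‖)
    (hv0 : v ≠ 0) {δ : ℝ} (hδ0 : 0 < δ) (hδ1 : δ < 1) (hδr : (1 + δ) * ‖v‖ < r) :
    Metric.infDist (a + (1 + δ) • v) X = (1 + δ) * ‖v‖ := by
  have hvpos : 0 < ‖v‖ := norm_pos_iff.2 hv0
  have hδv : 0 < δ * ‖v‖ := by positivity
  obtain ⟨z, p, hp, hge, hle, hray⟩ := hX.exists_norm_smul_sub_eq hδv.le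
    (hv.symm ▸ hvpos) (by rw [hv]; linarith)
  have hnorm : ‖z - p‖ = Metric.infDist z X := by rw [← hp.2, dist_eq_norm]
  rw [hv, ← hnorm] at hge hle
  have hseg : ‖z - p‖ • (a + v - p) = (‖z - p‖ - δ * ‖v‖) • (z - p) := by
    rw [show a + v - p = (z - p) - (z - (a + v)) by abel, smul_sub, hray, sub_smul]
  have hδle : δ * ‖v‖ ≤ ‖z - p‖ := (mul_le_of_le_one_left hvpos.le hδ1.le).trans hge
  have hdist : ‖a + v - p‖ = ‖z - p‖ - δ * ‖v‖ := by
    have := congrArg norm hseg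
    rw [norm_smul, norm_smul, norm_norm, Real.norm_of_nonneg (by linarith), mul_comm] at this
    exact mul_right_cancel₀ (by linarith) this
  have hpv : ‖v‖ ≤ ‖a + v - p‖ := by
    rw [← hv, ← dist_eq_norm]; exact Metric.infDist_le_dist_of_mem hp.1
  have hpa : p = a := by
    refine (hX (a + v) (by linarith)).unique ⟨hp.1, ?_⟩ ⟨ha, by simp [hv]⟩
    rw [dist_eq_norm, hv]; linarith
  subst hpa
  rw [add_sub_cancel_left] at hseg hdist
  have hza : ‖z - p‖ = (1 + δ) * ‖v‖ := by linarith
  have hz : p + (1 + δ) • v = z := by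
    rw [hza, show (1 + δ) * ‖v‖ - δ * ‖v‖ = ‖v‖ by ring, mul_comm, mul_smul] at hseg
    rw [smul_right_injective V hvpos.ne' hseg, add_sub_cancel]
  rw [hz, ← hnorm, hza]

theorem HasUniqueClosestPoints.infDist_add_smul [ProperSpace V] {r : ℝ}
    (hX : HasUniqueClosestPoints X r) {a v : V} (ha : a ∈ X) (hv : Metric.infDist (a + v) X = ‖v‖)
    {s : ℝ} (hs : 1 ≤ s) (hsr : s * ‖v‖ < r) : Metric.infDist (a + s • v) X = s * ‖v‖ := by
  rcases eq_or_ne v 0 with rfl | hv0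
  · simpa using hv
  have hclosed : IsClosed {τ : ℝ | Metric.infDist (a + τ • v) X = τ * ‖v‖} :=
    isClosed_eq ((Metric.continuous_infDist_pt X).comp (by fun_prop)) (by fun_prop)
  refine (hclosed.inter isClosed_Icc).Icc_subset_of_forall_exists_gt (a := 1) (b := s) (by simpa)
    (fun τ ⟨hτ, hτ1, hτs⟩ σ hσ => ?_) ⟨hs, le_rfl⟩
  have hτ0 : 0 < τ := one_pos.trans_le hτ1
  obtain ⟨ρ, hτρ, hρ⟩ := exists_between (lt_min (lt_min (mem_Ioi.1 hσ) hτs)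
    (show τ < 2 * τ by linarith))
  obtain ⟨⟨hρσ, hρs⟩, hρτ⟩ : (ρ < σ ∧ ρ < s) ∧ ρ < 2 * τ := by simpa [lt_min_iff] using hρ
  have hnorm : ‖τ • v‖ = τ * ‖v‖ := by rw [norm_smul, Real.norm_of_nonneg hτ0.le]
  have hρ' : (1 + (ρ / τ - 1)) * τ = ρ := by field_simp; ring
  have hext := hX.infDist_add_one_add_smul ha (v := τ • v) (δ := ρ / τ - 1) (by rwa [hnorm])
    (smul_ne_zero hτ0.ne' hv0) (by rwa [sub_pos, one_lt_div hτ0])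
    (by rw [sub_lt_iff_lt_add, div_lt_iff₀ hτ0]; linarith)
    (by rw [hnorm, ← mul_assoc, hρ']; exact (by gcongr : ρ * ‖v‖ ≤ s * ‖v‖).trans_lt hsr)
  rw [smul_smul, hnorm, ← mul_assoc, hρ'] at hext
  exact ⟨ρ, hext, hτρ, hρσ.le⟩

theorem two_mul_inner_sub_le_of_infDist_add_smul_eq {a v y : V} {s : ℝ}
    (hs : Metric.infDist (a + s • v) X = s * ‖v‖) (hy : y ∈ X) :
    2 * s * ⟪y - a, v⟫ ≤ ‖y - a‖ ^ 2 := by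
  have hle : s * ‖v‖ ≤ ‖s • v - (y - a)‖ := by
    rw [← hs, show s • v - (y - a) = a + s • v - y by abel, ← dist_eq_norm]
    exact Metric.infDist_le_dist_of_mem hy
  have hsq : (s * ‖v‖) ^ 2 ≤ ‖s • v - (y - a)‖ ^ 2 := by
    have : 0 ≤ s * ‖v‖ := hs ▸ Metric.infDist_nonneg
    gcongr
  rw [norm_sub_sq_real, norm_smul, mul_pow, mul_pow, Real.norm_eq_abs, sq_abs,
    real_inner_smul_left, real_inner_comm] at hsq
  linarith

theorem HasUniqueClosestPoints.inner_sub_le_of_isClosestPoint [ProperSpace V] {r : ℝ}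
    (hX : HasUniqueClosestPoints X r) {z q y : V} (hq : IsClosestPoint X z q)
    (hz : Metric.infDist z X < r) (hy : y ∈ X) :
    2 * r * ⟪y - q, z - q⟫ ≤ ‖z - q‖ * ‖y - q‖ ^ 2 := by
  have hdist : Metric.infDist z X = ‖z - q‖ := by rw [← hq.2, dist_eq_norm]
  rcases eq_or_ne z q with rfl | hne
  · simp
  have hpos : 0 < ‖z - q‖ := norm_pos_iff.2 (sub_ne_zero.2 hne)
  have hlim : Tendsto (fun s : ℝ => 2 * s * ⟪y - q, z - q⟫) (𝓝[<] (r / ‖z - q‖))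
      (𝓝 (2 * (r / ‖z - q‖) * ⟪y - q, z - q⟫)) :=
    (Continuous.tendsto (by fun_prop) _).mono_left nhdsWithin_le_nhds
  have hbound : 2 * (r / ‖z - q‖) * ⟪y - q, z - q⟫ ≤ ‖y - q‖ ^ 2 := by
    refine le_of_tendsto hlim ?_
    filter_upwards [Ico_mem_nhdsLT ((one_lt_div hpos).2 (hdist ▸ hz))] with s ⟨hs1, hsr⟩
    exact two_mul_inner_sub_le_of_infDist_add_smul_eq
      (hX.infDist_add_smul hq.1 (by rwa [add_sub_cancel]) hs1 ((lt_div_iff₀ hpos).1 hsr)) hy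
  calc 2 * r * ⟪y - q, z - q⟫ = ‖z - q‖ * (2 * (r / ‖z - q‖) * ⟪y - q, z - q⟫) := by field_simp
    _ ≤ ‖z - q‖ * ‖y - q‖ ^ 2 := by gcongr

end UniqueProjection

section PolarCone

variable {V : Type*} [NormedAddCommGroup V] [InnerProductSpace ℝ V] [ProperSpace V] {X : Set V}

theorem tendsto_inv_smul_closestPoint_sub {x n : V} (hx : x ∈ X)
    (hn : ∀ b ∈ posTangentConeAt X x, ⟪n, b⟫ ≤ 0) {q : ℝ → V}
    (hq : ∀ t, IsClosestPoint X (x + t • n) (q t)) :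
    Tendsto (fun t => t⁻¹ • (q t - x)) (𝓝[>] 0) (𝓝 0) := by
  have hbdd : ∀ᶠ t in 𝓝[>] (0 : ℝ), t⁻¹ • (q t - x) ∈ Metric.closedBall n ‖n‖ := by
    filter_upwards [self_mem_nhdsWithin] with t (ht : 0 < t)
    have hdist : dist (x + t • n) (q t) ≤ t * ‖n‖ := by
      rw [(hq t).2]
      refine (Metric.infDist_le_dist_of_mem hx).trans_eq ?_
      rw [dist_eq_norm, add_sub_cancel_left, norm_smul, Real.norm_of_nonneg ht.le]
    rw [mem_closedBall_iff_norm', show n - t⁻¹ • (q t - x) = t⁻¹ • (x + t • n - q t) by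
      rw [add_sub_right_comm, smul_add, inv_smul_smul₀ ht.ne', ← neg_sub x, smul_neg]; abel,
      norm_smul, norm_inv, Real.norm_of_nonneg ht.le, ← dist_eq_norm, inv_mul_le_iff₀ ht]
    exact hdist
  refine (isCompact_closedBall n ‖n‖).tendsto_nhds_of_unique_mapClusterPt hbdd fun τ hτn hτ => ?_
  obtain ⟨U, hU, hτU⟩ := mapClusterPt_iff_ultrafilter.1 hτ
  have hpos : ∀ᶠ t in (U : Filter ℝ), 0 < t := hU self_mem_nhdsWithin
  have hqx : Tendsto (fun t => q t - x) U (𝓝 0) := by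
    have hid : Tendsto (fun t : ℝ => t) U (𝓝 0) := hU.trans nhdsWithin_le_nhds
    refine (zero_smul ℝ τ ▸ hid.smul hτU).congr' (hpos.mono fun t ht => ?_)
    exact smul_inv_smul₀ ht.ne' _
  have hτT : τ ∈ posTangentConeAt X x := by
    refine mem_tangentConeAt_of_seq (U : Filter ℝ) (fun t => t⁻¹.toNNReal) _ hqx
      (Eventually.of_forall fun t => by simpa using (hq t).1) (hτU.congr' ?_)
    filter_upwards [hpos] with t ht
    rw [NNReal.smul_def, Real.coe_toNNReal _ (inv_nonneg.2 ht.le)]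
  have hsq : ‖n - τ‖ ^ 2 ≤ ‖n‖ ^ 2 := by
    gcongr
    exact mem_closedBall_iff_norm'.1 hτn
  rw [norm_sub_sq_real] at hsq
  rw [← real_inner_self_nonpos, real_inner_self_eq_norm_sq]
  linarith [hn τ hτT]

theorem HasUniqueClosestPoints.inner_sub_le_of_polar {r : ℝ} (hX : HasUniqueClosestPoints X r)
    (hr : 0 < r) {x n y : V} (hx : x ∈ X) (hn : ∀ b ∈ posTangentConeAt X x, ⟪n, b⟫ ≤ 0)
    (hy : y ∈ X) : 2 * r * ⟪y - x, n⟫ ≤ ‖n‖ * ‖y - x‖ ^ 2 := by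
  choose q hq using fun t : ℝ => exists_isClosestPoint (hX.isClosed hr) ⟨x, hx⟩ (x + t • n)
  have hslope := tendsto_inv_smul_closestPoint_sub hx hn hq
  have hid : Tendsto (fun t : ℝ => t) (𝓝[>] 0) (𝓝 0) := nhdsWithin_le_nhds
  have hqx : Tendsto (fun t => q t - x) (𝓝[>] 0) (𝓝 0) := by
    refine (zero_smul ℝ (0 : V) ▸ hid.smul hslope).congr' ?_
    filter_upwards [self_mem_nhdsWithin] with t (ht : 0 < t)
    exact smul_inv_smul₀ ht.ne' _
  have hyq : Tendsto (fun t => (y - x) - (q t - x)) (𝓝[>] 0) (𝓝 (y - x)) := by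
    simpa using hqx.const_sub (y - x)
  have hν : Tendsto (fun t => n - t⁻¹ • (q t - x)) (𝓝[>] 0) (𝓝 n) := by
    simpa using hslope.const_sub n
  refine le_of_tendsto_of_tendsto ((hyq.inner hν).const_mul (2 * r))
    (hν.norm.mul (hyq.norm.pow 2)) ?_
  have hnear : ∀ᶠ t in 𝓝[>] (0 : ℝ), Metric.infDist (x + t • n) X < r :=
    ((Metric.continuous_infDist_pt X).tendsto x |>.comp
      (tendsto_add_smul_nhdsGT_zero x n)).eventually_lt_const
        (by rwa [Metric.infDist_zero_of_mem hx])
  filter_upwards [hnear, self_mem_nhdsWithin] with t htr (ht : 0 < t)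
  have hprox := hX.inner_sub_le_of_isClosestPoint (hq t) htr hy
  have hz : x + t • n - q t = t • (n - t⁻¹ • (q t - x)) := by
    rw [smul_sub, smul_inv_smul₀ ht.ne']; abel
  rw [hz, real_inner_smul_right, norm_smul, Real.norm_of_nonneg ht.le] at hprox
  rw [sub_sub_sub_cancel_right]
  exact le_of_mul_le_mul_left (by linarith) ht

end PolarCone

section TangentCone

variable {V : Type*} [AddCommGroup V] [Module ℝ V] [TopologicalSpace V] [ContinuousNeg V]

theorem mem_or_neg_mem_posTangentConeAt {S : Set V} {x u : V} (hu : u ∈ tangentConeAt ℝ S x) :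
    u ∈ posTangentConeAt S x ∨ -u ∈ posTangentConeAt S x := by
  obtain ⟨α, l, hl, c, e, he, hmem, hlim⟩ := exists_fun_of_mem_tangentConeAt hu
  have of_frequently_nonneg : ∀ {b : α → ℝ} {v : V}, (∃ᶠ i in l, 0 ≤ b i) →
      Tendsto (fun i => b i • e i) l (𝓝 v) → v ∈ posTangentConeAt S x := by
    intro b v hb hbv
    have := frequently_iff_neBot.1 hb
    refine mem_tangentConeAt_of_seq (l ⊓ 𝓟 {i | 0 ≤ b i}) (fun i => (b i).toNNReal) e
      (he.mono_left inf_le_left) (hmem.filter_mono inf_le_left)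
      ((hbv.mono_left inf_le_left).congr' ?_)
    filter_upwards [mem_inf_of_right (mem_principal_self {i | 0 ≤ b i})] with i hi
    rw [NNReal.smul_def, Real.coe_toNNReal _ hi]
  rcases frequently_or_distrib.1 (Frequently.of_forall (f := l) fun i => le_total 0 (c i)) with
    hc | hc
  · exact .inl (of_frequently_nonneg hc hlim)
  · refine .inr (of_frequently_nonneg (hc.mono fun i hi => neg_nonneg.2 hi) ?_)
    simpa only [neg_smul] using hlim.neg

theorem tangentConeAt_subset_span_posTangentConeAt (S : Set V) (x : V) :
    tangentConeAt ℝ S x ⊆ Submodule.span ℝ (posTangentConeAt S x) := fun _ hu =>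
  (mem_or_neg_mem_posTangentConeAt hu).elim (fun h => Submodule.subset_span h) fun h =>
    (Submodule.neg_mem_iff _).1 (Submodule.subset_span h)

theorem exists_ne_zero_map_mem_span_posTangentConeAt {V W : Type*} [NormedAddCommGroup V]
    [NormedSpace ℝ V] [ProperSpace V] [NormedAddCommGroup W] [NormedSpace ℝ W] {F : V → W}
    {F' : V →L[ℝ] W} {S : Set V} {N : Set W} {x : V} (hF : HasFDerivAt F F' x) (hS : MapsTo F S N)
    (hx : AccPt x (𝓟 S)) : ∃ u ≠ 0, F' u ∈ Submodule.span ℝ (posTangentConeAt N (F x)) := by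
  obtain ⟨u, hu, hu0⟩ := tangentConeAt_nonempty_of_properSpace (𝕜 := ℝ) hx
  have himage : F' u ∈ tangentConeAt ℝ (F '' S) (F x) := hF.hasFDerivWithinAt.mapsTo_tangent_cone hu
  exact ⟨u, hu0, tangentConeAt_subset_span_posTangentConeAt N (F x)
    (tangentConeAt_mono hS.image_subset himage)⟩

end TangentCone

section ProximalBound

variable {V : Type*} [NormedAddCommGroup V] [InnerProductSpace ℝ V] {N : Set (V × V)}
  {T : Submodule ℝ (V × V)} {p : V × V} {σ K : ℝ}

/-- Uniform proximality of a set `N` of pairs (point, normal). The factor `σ` is there to treat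
inner normals (`σ < 0`) together with outer ones. -/
def HasProximalBound (N : Set (V × V)) (σ K : ℝ) : Prop :=
  ∀ p ∈ N, ∀ q ∈ N, σ * ⟪q.1 - p.1, p.2⟫ ≤ K * ‖q.1 - p.1‖ ^ 2

theorem HasProximalBound.inner_fst_eq_zero (hN : HasProximalBound N σ K) (hσ : σ ≠ 0) (hp : p ∈ N)
    (hT : (T : Set (V × V)) = posTangentConeAt N p) {w : V × V} (hw : w ∈ T) :
    ⟪w.1, p.2⟫ = 0 := by
  have hmax : IsMaxOn (fun q : V × V => σ * ⟪q.1 - p.1, p.2⟫ - K * ‖q.1 - p.1‖ ^ 2) N p :=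
    fun q hq => by simpa using hN p hp q hq
  have hsub : HasFDerivAt (fun q : V × V => q.1 - p.1) (ContinuousLinearMap.fst ℝ V V) p :=
    hasFDerivAt_fst.sub_const p.1
  have hderiv :=
    ((hsub.inner ℝ (hasFDerivAt_const p.2 p)).const_mul σ).sub (hsub.norm_sq.const_mul K)
  have hzero := hmax.localize.hasFDerivWithinAt_eq_zero hderiv.hasFDerivWithinAt (hT.subset hw)
    (hT.subset (T.neg_mem hw))
  simpa [hσ] using hzero

theorem HasProximalBound.neg_mul_inner_le (hN : HasProximalBound N σ K) (hp : p ∈ N) {w : V × V}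
    (hw : w ∈ posTangentConeAt N p) : -(σ * ⟪w.1, w.2⟫) ≤ 2 * K * ‖w.1‖ ^ 2 := by
  obtain ⟨α, l, hl, c, e, -, hmem, hlim⟩ := exists_fun_of_mem_tangentConeAt hw
  have hfst : Tendsto (fun i => c i • (e i).1) l (𝓝 w.1) := (continuous_fst.tendsto w).comp hlim
  have hsnd : Tendsto (fun i => c i • (e i).2) l (𝓝 w.2) := (continuous_snd.tendsto w).comp hlim
  refine le_of_tendsto_of_tendsto ((hfst.inner hsnd).const_mul σ).neg
    ((hfst.norm.pow 2).const_mul (2 * K)) (hmem.mono fun i hi => ?_)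
  have hpq := hN _ hp _ hi
  have hqp := hN _ hi _ hp
  simp only [Prod.fst_add, Prod.snd_add, add_sub_cancel_left, sub_add_cancel_left, norm_neg,
    inner_neg_left, inner_add_right] at hpq hqp
  have hsum : -(σ * ⟪(e i).1, (e i).2⟫) ≤ 2 * K * ‖(e i).1‖ ^ 2 := by linarith
  have hscaled := mul_le_mul_of_nonneg_left hsum (sq_nonneg (c i : ℝ))
  simp only [NNReal.smul_def, real_inner_smul_left, real_inner_smul_right, norm_smul,
    Real.norm_of_nonneg (c i).coe_nonneg]
  linarith

theorem eq_zero_of_forall_mul_le {𝕜 : Type*} [Field 𝕜] [LinearOrder 𝕜] [IsStrictOrderedRing 𝕜]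
    {a b : 𝕜} (h : ∀ t : 𝕜, t * a ≤ b) : a = 0 := by
  by_contra ha
  have := h ((b + 1) / a)
  rw [div_mul_cancel₀ _ ha] at this
  linarith

theorem HasProximalBound.inner_vertical_eq_zero (hN : HasProximalBound N σ K) (hσ : σ ≠ 0)
    (hp : p ∈ N) (hT : (T : Set (V × V)) = posTangentConeAt N p) {u v w : V} (huv : (u, v) ∈ T)
    (hw : ((0 : V), w) ∈ T) : ⟪u, w⟫ = 0 := by
  have hbound : ∀ t : ℝ, t * -(σ * ⟪u, w⟫) ≤ 2 * K * ‖u‖ ^ 2 + σ * ⟪u, v⟫ := fun t => by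
    have hmem : (u, v) + t • ((0 : V), w) ∈ posTangentConeAt N p :=
      hT ▸ T.add_mem huv (T.smul_mem t hw)
    have hle := hN.neg_mul_inner_le hp hmem
    simp only [Prod.fst_add, Prod.snd_add, Prod.smul_fst, Prod.smul_snd, smul_zero, add_zero,
      inner_add_right, real_inner_smul_right] at hle
    linarith
  exact (mul_eq_zero.1 (neg_eq_zero.1 (eq_zero_of_forall_mul_le hbound))).resolve_left hσ

end ProximalBound

section Derivatives

variable {V : Type*} [NormedAddCommGroup V] [InnerProductSpace ℝ V]

theorem exists_hasFDerivAt_gradient [CompleteSpace V] {f : V → ℝ} {x : V}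
    (hf : ContDiffAt ℝ 2 f x) :
    ∃ G : V →L[ℝ] V, HasFDerivAt (gradient f) G x ∧
      ∀ u v, ⟪u, G v⟫ = fderiv ℝ (fderiv ℝ f) x u v := by
  have hdiff : DifferentiableAt ℝ (fderiv ℝ f) x :=
    (hf.fderiv_right (m := 1) (by norm_num)).differentiableAt one_ne_zero
  let J : StrongDual ℝ V →L[ℝ] V :=
    { toFun := (InnerProductSpace.toDual ℝ V).symm
      map_add' := map_add _
      map_smul' := fun c v => by simp
      cont := (InnerProductSpace.toDual ℝ V).symm.continuous }
  refine ⟨J.comp (fderiv ℝ (fderiv ℝ f) x), J.hasFDerivAt.comp x hdiff.hasFDerivAt, fun u v => ?_⟩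
  have hsymm : IsSymmSndFDerivAt ℝ f x := hf.isSymmSndFDerivAt (by simp)
  calc ⟪u, J (fderiv ℝ (fderiv ℝ f) x v)⟫ = ⟪J (fderiv ℝ (fderiv ℝ f) x v), u⟫ :=
        real_inner_comm _ _
    _ = fderiv ℝ (fderiv ℝ f) x v u := InnerProductSpace.toDual_symm_apply
    _ = fderiv ℝ (fderiv ℝ f) x u v := hsymm.eq v u

theorem exists_hasFDerivAt_inv_norm_smul {W : Type*} [NormedAddCommGroup W] [NormedSpace ℝ W]
    {g : W → V} {G : W →L[ℝ] V} {x : W} (hg : HasFDerivAt g G x) (hx : g x ≠ 0) :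
    ∃ D : W →L[ℝ] V, HasFDerivAt (fun y => ‖g y‖⁻¹ • g y) D x ∧
      ∀ u v, ⟪u, g x⟫ = 0 → ‖g x‖ * ⟪u, D v⟫ = ⟪u, G v⟫ := by
  have hnorm : ‖g x‖ ≠ 0 := norm_ne_zero_iff.2 hx
  have hinv : DifferentiableAt ℝ (fun y => ‖g y‖⁻¹) x := (hg.differentiableAt.norm ℝ hx).inv hnorm
  refine ⟨_, hinv.hasFDerivAt.smul hg, fun u v hu => ?_⟩
  simp only [add_apply, smul_apply, ContinuousLinearMap.smulRight_apply, inner_add_right,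
    real_inner_smul_right, hu, mul_zero, add_zero]
  exact mul_inv_cancel_left₀ hnorm _

theorem exists_hasFDerivAt_unitNormal {d : ℕ} {f : E d → ℝ} {x : E d} (hf : ContDiffAt ℝ 2 f x)
    (hgrad : gradient f x ≠ 0) :
    ∃ D : E d →L[ℝ] E d, HasFDerivAt (unitNormal f) D x ∧
      ∀ u v, ⟪u, unitNormal f x⟫ = 0 → hessian f x u v + ‖gradient f x‖ * ⟪u, D v⟫ = 0 := by
  obtain ⟨G, hG, hGf⟩ := exists_hasFDerivAt_gradient hf
  obtain ⟨D, hD, hDG⟩ := exists_hasFDerivAt_inv_norm_smul hG hgrad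
  refine ⟨-D, hD.neg, fun u v hu => ?_⟩
  have hperp : ⟪u, gradient f x⟫ = 0 := by
    rw [unitNormal, inner_neg_right, real_inner_smul_right, neg_eq_zero] at hu
    exact (mul_eq_zero.1 hu).resolve_left (inv_ne_zero (norm_ne_zero_iff.2 hgrad))
  rw [neg_apply, inner_neg_right, mul_neg, hDG u v hperp, hGf]
  exact add_neg_cancel _

end Derivatives

section NormalBundle

variable {d : ℕ} {X : Set (E d)}

theorem exists_hasUniqueClosestPoints_of_reach_pos (h : 0 < reach X) (hne : X.Nonempty) :
    ∃ r : ℝ, 0 < r ∧ HasUniqueClosestPoints X r := by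
  obtain ⟨t, ht, ht0⟩ := lt_sSup_iff.1 h
  obtain ⟨r, -, hr0, hrt⟩ := ENNReal.lt_iff_exists_real_btwn.1 ht0
  have hr : 0 < r := by simpa using hr0
  refine ⟨r, hr, fun z hz => ?_⟩
  have hfin : Metric.infEDist z X ≠ ⊤ := Metric.infEDist_ne_top hne
  have hdist (p : E d) : edist z p = Metric.infEDist z X ↔ dist z p = Metric.infDist z X := by
    rw [Metric.infDist, dist_edist, ENNReal.toReal_eq_toReal_iff' (edist_ne_top _ _) hfin]
  have hlt : Metric.infEDist z X < t := by
    refine lt_trans ?_ hrt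
    rw [← ENNReal.ofReal_toReal hfin]
    exact (ENNReal.ofReal_lt_ofReal_iff hr).2 hz
  simpa only [IsClosestPoint, hdist] using ht z hlt

theorem isClosed_of_reach_pos (h : 0 < reach X) : IsClosed X := by
  rcases X.eq_empty_or_nonempty with rfl | hne
  · exact isClosed_empty
  · obtain ⟨r, hr, hX⟩ := exists_hasUniqueClosestPoints_of_reach_pos h hne
    exact hX.isClosed hr

theorem exists_inner_sub_le_of_reach_pos (h : 0 < reach X) :
    ∃ K : ℝ, ∀ x ∈ X, ∀ n ∈ polarCone (posTangentConeAt X x), ‖n‖ = 1 → ∀ y ∈ X,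
      ⟪y - x, n⟫ ≤ K * ‖y - x‖ ^ 2 := by
  rcases X.eq_empty_or_nonempty with rfl | hne
  · exact ⟨0, by simp⟩
  obtain ⟨r, hr, hX⟩ := exists_hasUniqueClosestPoints_of_reach_pos h hne
  refine ⟨(2 * r)⁻¹, fun x hx n hn hn1 y hy => ?_⟩
  rw [le_inv_mul_iff₀ (by positivity)]
  simpa only [hn1, one_mul] using hX.inner_sub_le_of_polar hr hx hn hy

theorem frontier_subset_complSet (X : Set (E d)) : frontier X ⊆ complSet X := by
  rw [← frontier_compl]
  exact frontier_subset_closure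

theorem exists_hasProximalBound_normalBundle (hX : 0 < reach X ∨ 0 < reach (complSet X)) :
    ∃ σ K : ℝ, σ ≠ 0 ∧ HasProximalBound (normalBundle X) σ K := by
  by_cases hr : 0 < reach X
  · obtain ⟨K, hK⟩ := exists_inner_sub_le_of_reach_pos hr
    have hsub : frontier X ⊆ X := (isClosed_of_reach_pos hr).frontier_subset
    refine ⟨1, K, one_ne_zero, fun p ⟨hp, hn, hn1⟩ q ⟨hq, _⟩ => ?_⟩
    rw [normalCone, if_pos hr] at hn
    rw [one_mul]
    exact hK _ (hsub hp) _ hn hn1 _ (hsub hq)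
  · obtain ⟨K, hK⟩ := exists_inner_sub_le_of_reach_pos (hX.resolve_left hr)
    have hsub : frontier X ⊆ complSet X := frontier_subset_complSet X
    refine ⟨-1, K, by norm_num, fun p ⟨hp, hn, hn1⟩ q ⟨hq, _⟩ => ?_⟩
    rw [normalCone, if_neg hr, if_neg hp.2] at hn
    rw [neg_one_mul, ← inner_neg_right]
    exact hK _ (hsub hp) _ hn ((norm_neg _).trans hn1) _ (hsub hq)

theorem smul_mem_polarCone {B : Set (E d)} {n : E d} (hn : n ∈ polarCone B) {c : ℝ} (hc : 0 ≤ c) :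
    c • n ∈ polarCone B := fun b hb => by
  rw [real_inner_smul_left]
  exact mul_nonpos_of_nonneg_of_nonpos hc (hn b hb)

theorem smul_mem_normalCone {x n : E d} (hn : n ∈ normalCone X x) {c : ℝ} (hc : 0 ≤ c) :
    c • n ∈ normalCone X x := by
  unfold normalCone at hn ⊢
  split_ifs at hn ⊢
  · exact smul_mem_polarCone hn hc
  · rw [mem_singleton_iff] at hn ⊢
    rw [hn, smul_zero]
  · rw [Set.mem_neg] at hn ⊢
    rw [← smul_neg]
    exact smul_mem_polarCone hn hc

theorem eq_zero_of_mem_normalCone_of_mem_interior {x n : E d} (hx : x ∈ interior X)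
    (hn : n ∈ normalCone X x) : n = 0 := by
  unfold normalCone at hn
  split_ifs at hn
  · have htan : n ∈ posTangentConeAt X x := by
      rw [posTangentConeAt, tangentConeAt_of_mem_nhds (mem_interior_iff_mem_nhds.1 hx)]
      exact mem_univ n
    exact real_inner_self_nonpos.1 (hn n htan)
  · exact hn

theorem IsCriticalPoint.mem_normalBundle {f : E d → ℝ} {x : E d} (h : IsCriticalPoint f X x)
    (hgrad : gradient f x ≠ 0) : (x, unitNormal f x) ∈ normalBundle X := by
  obtain ⟨hx, hn⟩ := h
  rw [Set.mem_neg] at hn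
  refine ⟨⟨subset_closure hx, fun hint => hgrad ?_⟩, ?_, ?_⟩
  · exact neg_eq_zero.1 (eq_zero_of_mem_normalCone_of_mem_interior hint hn)
  · rw [unitNormal, ← smul_neg]
    exact smul_mem_normalCone hn (inv_nonneg.2 (norm_nonneg _))
  · rw [unitNormal, norm_neg, norm_smul, norm_inv, norm_norm,
      inv_mul_cancel₀ (norm_ne_zero_iff.2 hgrad)]

end NormalBundle

section RestrictedHessian

variable {d : ℕ} {X : Set (E d)} {f : E d → ℝ} {x : E d}

theorem secondFundamentalForm_apply {σ K : ℝ} (hN : HasProximalBound (normalBundle X) σ K)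
    (hσ : σ ≠ 0) {p : E d × E d} (hp : p ∈ normalBundle X)
    (hT : (bundleTangent X p : Set (E d × E d)) = posTangentConeAt (normalBundle X) p)
    (u u' : baseSpace (bundleTangent X p)) {v' : E d} (hv' : ((u' : E d), v') ∈ bundleTangent X p) :
    secondFundamentalForm X p u u' = ⟪(u : E d), v'⟫ := by
  refine pairingForm_apply _ (fun w hw u₁ hu₁ => ?_) u u' v' hv'
  obtain ⟨⟨_, v₁⟩, hv₁, rfl⟩ := hu₁
  exact hN.inner_vertical_eq_zero hσ hp hT hv₁ hw

theorem exists_ne_zero_mem_bundleTangent_of_accPt {D : E d →L[ℝ] E d}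
    (hD : HasFDerivAt (unitNormal f) D x) (hcont : ContinuousAt (gradient f) x)
    (hgrad : gradient f x ≠ 0) (hacc : AccPt x (𝓟 {y | IsCriticalPoint f X y})) :
    ∃ u ≠ 0, (u, D u) ∈ bundleTangent X (x, unitNormal f x) :=
  exists_ne_zero_map_mem_span_posTangentConeAt ((hasFDerivAt_id x).prodMk hD)
    (fun _ hy => hy.2.mem_normalBundle hy.1) (hacc.nhds_inter (hcont.eventually_ne hgrad))

theorem exists_ne_zero_forall_restrictedHessian_eq_zero
    (hX : 0 < reach X ∨ 0 < reach (complSet X)) (hf : ContDiffAt ℝ 2 f x)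
    (hgrad : gradient f x ≠ 0) (hp : (x, unitNormal f x) ∈ normalBundle X)
    (hT : (bundleTangent X (x, unitNormal f x) : Set (E d × E d)) =
      posTangentConeAt (normalBundle X) (x, unitNormal f x))
    (hacc : AccPt x (𝓟 {y | IsCriticalPoint f X y})) :
    ∃ u ≠ 0, ∀ u', restrictedHessian f X x u' u = 0 := by
  obtain ⟨σ, K, hσ, hN⟩ := exists_hasProximalBound_normalBundle hX
  obtain ⟨G, hG, -⟩ := exists_hasFDerivAt_gradient hf
  obtain ⟨D, hD, hDf⟩ := exists_hasFDerivAt_unitNormal hf hgrad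
  obtain ⟨u, hu0, hu⟩ := exists_ne_zero_mem_bundleTangent_of_accPt hD hG.continuousAt hgrad hacc
  refine ⟨⟨u, _, hu, rfl⟩, fun h => hu0 (congrArg Subtype.val h), fun u' => ?_⟩
  have hperp : ⟪(u' : E d), unitNormal f x⟫ = 0 := by
    obtain ⟨w, hw, hwu⟩ := u'.2
    rw [← hwu]
    exact hN.inner_fst_eq_zero hσ hp hT hw
  calc restrictedHessian f X x u' ⟨u, _⟩
      = hessian f x u' u +
          ‖gradient f x‖ * secondFundamentalForm X (x, unitNormal f x) u' ⟨u, _⟩ := rfl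
    _ = hessian f x u' u + ‖gradient f x‖ * ⟪(u' : E d), D u⟫ := by
      rw [secondFundamentalForm_apply hN hσ hp hT _ _ hu]
    _ = 0 := hDf u' u hperp

end RestrictedHessian

theorem exists_mem_nhds_inter_eq_singleton {Y : Type*} [TopologicalSpace Y] {C : Set Y} {x : Y}
    (hx : x ∈ C) (hacc : ¬AccPt x (𝓟 C)) : ∃ U ∈ 𝓝 x, U ∩ C = {x} := by
  simp only [accPt_iff_nhds, not_forall, not_exists, not_and, not_not] at hacc
  obtain ⟨U, hU, hUC⟩ := hacc
  exact ⟨U, hU, Subset.antisymm hUC (singleton_subset_iff.2 ⟨mem_of_mem_nhds hU, hx⟩)⟩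

end MorseReach

theorem mainTheorem9_general {d : ℕ} {X : Set (MorseReach.E d)}
    (hX : 0 < MorseReach.reach X ∨ 0 < MorseReach.reach (MorseReach.complSet X))
    {f : MorseReach.E d → ℝ} {x : MorseReach.E d} (hf : ContDiffAt ℝ 2 f x)
    (hcrit : MorseReach.IsCriticalPoint f X x) (hgrad : gradient f x ≠ 0)
    (hT : (MorseReach.bundleTangent X (x, MorseReach.unitNormal f x) :
        Set (MorseReach.E d × MorseReach.E d)) =
      posTangentConeAt (MorseReach.normalBundle X) (x, MorseReach.unitNormal f x))
    (hnd : (MorseReach.restrictedHessian f X x).Nondegenerate) :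
    ∃ U ∈ 𝓝 x, U ∩ {y | MorseReach.IsCriticalPoint f X y} = {x} := by
  refine MorseReach.exists_mem_nhds_inter_eq_singleton hcrit fun hacc => ?_
  obtain ⟨u, hu0, hu⟩ := MorseReach.exists_ne_zero_forall_restrictedHessian_eq_zero hX hf hgrad
    (hcrit.mem_normalBundle hgrad) hT hacc
  exact hu0 (hnd.2 u hu)

theorem mainTheorem9 (d : ℕ) (X : Set (MorseReach.E d))
    (hX : 0 < MorseReach.reach X ∨ MorseReach.IsComplementaryRegular X)
    (f : MorseReach.E d → ℝ) (hf : ContDiff ℝ 2 f) (x : MorseReach.E d)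
    (hx : MorseReach.IsNondegenerateCriticalPoint f X x) :
    ∃ U ∈ 𝓝 x, U ∩ {y | MorseReach.IsCriticalPoint f X y} = {x} := by
  exact mainTheorem9_general (hX.imp_right (·.reach_compl_pos)) hf.contDiffAt hx.isCriticalPoint
    hx.gradient_ne_zero hx.isRegularPair.coe_eq hx.nondegenerate
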